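/- Let $G$ and $G'$ be finite abelian groups. For a subset $G_0\subset G$ let $\mathcal B(G_0)$ be the monoid of zero-sum sequences over $G_0$ (finite unordered sequences of terms from $G_0$, repetition allowed, with sum $0$, under concatenation). For $B\in\mathcal B(G_0)$ let $\mathsf L(B)\subset\mathbb N_0$ be the set of all $k$ such that $B$ is a product of $k$ atoms (minimal zero-sum sequences) of $\mathcal B(G_0)$, so that $\mathsf L(1)=\{0\}$, and put $\mathcal L(G_0)=\{\mathsf L(B)\mid B\in\mathcal B(G_0)\}$. For $L\in\mathcal L(G_0)$ put $\rho(L)=\sup L/\min L$, with $\rho(\{0\})=1$, and let $\Delta(L)$ be the set of successive distances of $L$, i.e. all $b-a$ with $a,b\in L$, $a<b$ and $[a,b]\cap L=\{a,b\}$. Put $\rho(G_0)=\sup\{\rho(L)\mid L\in\mathcal L(G_0)\}$ and $\Delta(G_0)=\bigcup_{L\in\mathcal L(G_0)}\Delta(L)$; the set $G_0$ is non-half-factorial if $\Delta(G_0)\neq\emptyset$. For $d\in\mathbb N=\{1,2,\dots\}$ and $\ell\in\mathbb N_0$, a set $L\subset\mathbb Z$ is an AAP with difference $d$ and length $\ell$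 if there are $y\in\mathbb Z$ and $M\in\mathbb N_0$ such that $$L=y+(L'\cup\{0,d,\ldots,\ell d\}\cup L'')\subset y+d\mathbb Z,\qquad L'\subset[-M,-1],\quad L''\subset \ell d+[1,M].$$ Let $\Delta_1(G)$ be the set of all $d\in\mathbb N$ such that for every $k\in\mathbb N$ some $L\in\mathcal L(G)$ is an AAP with difference $d$ and length at least $k$. For $d\in\Delta_1(G)$ define $$\rho(G,d,k)=\sup\{\rho(L)\mid L\in\mathcal L(G)\text{ is an AAP with difference } d\text{ and length at least }k\},\qquad \rho(G,d)=\lim_{k\to\infty}\rho(G,d,k),$$ $$\rho^*(G,d)=\max\{\rho(G_0)\mid G_0\subset G\text{ is non-half-factorial and } d\mid\min\Delta(G_0)\}.$$ **Proposition.** If $\mathcal L(G)=\mathcal L(G')$ and $d\in\Delta_1(G)$, then $d\in\Delta_1(G')$, $\rho(G,d)=\rho(G',d)$ and $\rho^*(G,d)=\rho^*(G',d)$. -/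

import Mathlib

open scoped ENNReal

namespace ZeroSumLengths

section Lengths

variable {G : Type*} [AddCommGroup G]

/-- The monoid `𝓑(G₀)` of zero-sum sequences over a subset `G₀` of an abelian group. Sequences over
`G` (order disregarded) are multisets, and the product of sequences is the sum of multisets. -/
def zeroSumMonoid (G₀ : Set G) : AddSubmonoid (Multiset G) where
  carrier := {S | (∀ g ∈ S, g ∈ G₀) ∧ S.sum = 0}
  zero_mem' := by simp
  add_mem' := by
    rintro S T ⟨hS, hS0⟩ ⟨hT, hT0⟩
    refine ⟨fun g hg => ?_, by simp [hS0, hT0]⟩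
    rcases Multiset.mem_add.1 hg with h | h
    · exact hS g h
    · exact hT g h

/-- The set of lengths `𝖫(B)` of `B ∈ 𝓑(G₀)`: all `k` such that `B` is a product of `k` atoms of
the (reduced) monoid `𝓑(G₀)`. The empty factorization gives `𝖫(1) = {0}`. -/
def lengthSet {G₀ : Set G} (B : zeroSumMonoid G₀) : Set ℕ :=
  {k | ∃ F : Multiset (zeroSumMonoid G₀),
    (∀ U ∈ F, AddIrreducible U) ∧ F.sum = B ∧ F.card = k}

/-- The system of sets of lengths `𝓛(G₀) = {𝖫(B) | B ∈ 𝓑(G₀)}`. -/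
def lengthSystem (G₀ : Set G) : Set (Set ℕ) :=
  Set.range fun B : zeroSumMonoid G₀ => lengthSet B

end Lengths

/-- The set `Δ(L)` of successive distances of `L`. -/
def distances (L : Set ℕ) : Set ℕ :=
  {d | ∃ a ∈ L, ∃ b ∈ L, a < b ∧ Set.Icc a b ∩ L = {a, b} ∧ d = b - a}

open scoped Classical in
/-- The elasticity `ρ(L) = sup L / min L`, where `ρ({0}) = 1`. -/
noncomputable def elasticity (L : Set ℕ) : ℝ≥0∞ :=
  if L = {0} then 1 else (⨆ n ∈ L, (n : ℝ≥0∞)) / ((sInf L : ℕ) : ℝ≥0∞)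

/-- `L ⊆ ℤ` is an almost arithmetical progression with difference `d`, length `ℓ` and bound `M`:
`L = y + (L' ∪ {0, d, …, ℓd} ∪ L'') ⊆ y + dℤ` with `L' ⊆ [-M, -1]` and `L'' ⊆ ℓd + [1, M]`. -/
def IsAAPWithBound (d ℓ M : ℕ) (L : Set ℤ) : Prop :=
  ∃ (y : ℤ) (L' L'' : Set ℤ),
    L' ⊆ Set.Icc (-(M : ℤ)) (-1) ∧
    L'' ⊆ Set.Icc ((ℓ : ℤ) * d + 1) ((ℓ : ℤ) * d + M) ∧
    L = (fun x => y + x) '' (L' ∪ {x | ∃ i : ℕ, i ≤ ℓ ∧ x = (i : ℤ) * d} ∪ L'') ∧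
    ∀ x ∈ L, (d : ℤ) ∣ x - y

/-- `L ⊆ ℕ` is an almost arithmetical progression with difference `d` and length `ℓ`
(with some bound `M`). -/
def IsAAP (d ℓ : ℕ) (L : Set ℕ) : Prop :=
  ∃ M : ℕ, IsAAPWithBound d ℓ M ((fun n : ℕ => (n : ℤ)) '' L)

section Invariants

variable {G : Type*} [AddCommGroup G]

/-- `Δ(G₀)`, the set of distances of `𝓑(G₀)`. The set `G₀` is half-factorial if this is empty. -/
def distanceSet (G₀ : Set G) : Set ℕ :=
  ⋃ L ∈ lengthSystem G₀, distances L

/-- The elasticity `ρ(G₀)` of `𝓑(G₀)`. -/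
noncomputable def setElasticity (G₀ : Set G) : ℝ≥0∞ :=
  ⨆ L ∈ lengthSystem G₀, elasticity L

variable (G)

/-- `Δ₁(G)`: all positive `d` such that, for every `k`, some `L ∈ 𝓛(G)` is an almost arithmetical
progression with difference `d` and length at least `k`. -/
def Delta₁ : Set ℕ :=
  {d | 0 < d ∧ ∀ k : ℕ, ∃ L ∈ lengthSystem (Set.univ : Set G), ∃ ℓ : ℕ, k ≤ ℓ ∧ IsAAP d ℓ L}

/-- `ρ(G, d, k)`, the supremum of the elasticities of all `L ∈ 𝓛(G)` that are almost arithmetical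
progressions with difference `d` and length at least `k`. -/
noncomputable def rhoLevel (d k : ℕ) : ℝ≥0∞ :=
  sSup {r | ∃ L ∈ lengthSystem (Set.univ : Set G),
    (∃ ℓ : ℕ, k ≤ ℓ ∧ IsAAP d ℓ L) ∧ r = elasticity L}

/-- `ρ(G, d) = lim ρ(G, d, k)` as `k → ∞`; the limit exists, see `tendsto_rhoLevel`. -/
noncomputable def rho (d : ℕ) : ℝ≥0∞ :=
  Filter.limUnder Filter.atTop fun k : ℕ => rhoLevel G d k

/-- The elasticities `ρ(G₀)` of the non-half-factorial subsets `G₀ ⊆ G` with `d ∣ min Δ(G₀)`. -/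
def rhoStarSet (d : ℕ) : Set ℝ≥0∞ :=
  {r | ∃ G₀ : Set G, (distanceSet G₀).Nonempty ∧ d ∣ sInf (distanceSet G₀) ∧
    r = setElasticity G₀}

/-- `ρ*(G, d)`, the maximum of `rhoStarSet G d`; see `isGreatest_rhoStar`. -/
noncomputable def rhoStar (d : ℕ) : ℝ≥0∞ :=
  sSup (rhoStarSet G d)

theorem tendsto_rhoLevel (d : ℕ) :
    Filter.Tendsto (fun k : ℕ => rhoLevel G d k) Filter.atTop (nhds (rho G d)) := by
  have h : Antitone fun k : ℕ => rhoLevel G d k := by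
    intro k m hkm
    refine sSup_le_sSup ?_
    rintro r ⟨L, hL, ⟨ℓ, hℓ, hA⟩, rfl⟩
    exact ⟨L, hL, ⟨ℓ, hkm.trans hℓ, hA⟩, rfl⟩
  exact tendsto_nhds_limUnder ⟨_, tendsto_atTop_iInf h⟩

theorem isGreatest_rhoStar [Finite G] (d : ℕ) (h : (rhoStarSet G d).Nonempty) :
    IsGreatest (rhoStarSet G d) (rhoStar G d) := by
  have hfin : (rhoStarSet G d).Finite := by
    refine (Set.finite_range fun G₀ : Set G => setElasticity G₀).subset ?_
    rintro r ⟨G₀, -, -, rfl⟩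
    exact ⟨G₀, rfl⟩
  exact ⟨h.csSup_mem hfin, fun r hr => le_sSup hr⟩

end Invariants

end ZeroSumLengths

/-! `Delta₁` and `rho` are defined from the system of sets of lengths alone, so only `rhoStar` needs
an argument. It is recovered from `rho` by ρ*(G, d) = sup of ρ(G, m) over the positive multiples m
of d (`rhoStar_eq_iSup_rho`); for m outside Δ₁(G) the term is 0.

For ≤ (`setElasticity_le_rho`): if m = min Δ(G₀) and S over G₀ has lengths l and l + m, then for
every A over G₀ the lengths of S^k A form an AAP with difference m and length k. Replacing A by high
powers of A makes the factor S^k irrelevant for the elasticity.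

For ≥ (`rho_le_rhoStar`): take B_k whose length sets are ever longer AAPs with difference d and
elasticity above r. Let G₀ consist of the elements whose multiplicity is unbounded along a suitable
subsequence. Removing a remainder of bounded size leaves a zero-sum sequence over G₀ and shifts
lengths by O(1) (`exists_mem_lengths_of_add`), so G₀ is non-half-factorial, d divides min Δ(G₀), and
ρ(G₀) ≥ r. -/

namespace ZeroSumLengths

section Multisets

variable {G : Type*} [AddCommGroup G]

/-! ### Atoms and lengths as plain multisets, independent of `G₀`. -/

/-- Minimal zero-sum sequences over `G`. -/
def IsMinZeroSum (U : Multiset G) : Prop :=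
  U ≠ 0 ∧ U.sum = 0 ∧ ∀ V ≤ U, V.sum = 0 → V = 0 ∨ V = U

/-- The lengths of the factorizations of a sequence over `G` into minimal zero-sum sequences. -/
def lengths (S : Multiset G) : Set ℕ :=
  {k | ∃ F : Multiset (Multiset G), (∀ U ∈ F, IsMinZeroSum U) ∧ F.sum = S ∧ F.card = k}

theorem isAddUnit_iff {G₀ : Set G} (U : zeroSumMonoid G₀) :
    IsAddUnit U ↔ (U : Multiset G) = 0 := by
  constructor
  · rintro ⟨u, rfl⟩
    have h : ((u : zeroSumMonoid G₀) : Multiset G) + ((-u : AddUnits _) : zeroSumMonoid G₀) = 0 := by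
      rw [← AddSubmonoid.coe_add, u.add_neg]; rfl
    exact (add_eq_zero.1 h).1
  · intro h
    have : U = 0 := Subtype.ext h
    rw [this]; exact isAddUnit_zero

theorem addIrreducible_iff {G₀ : Set G} (U : zeroSumMonoid G₀) :
    AddIrreducible U ↔ IsMinZeroSum (U : Multiset G) := by
  constructor
  · intro h
    refine ⟨fun h0 => h.not_isAddUnit ((isAddUnit_iff U).2 h0), U.2.2, fun V hV hV0 => ?_⟩
    obtain ⟨T, hT⟩ := Multiset.le_iff_exists_add.1 hV
    have hTs : T.sum = 0 := by
      have := U.2.2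
      rw [hT, Multiset.sum_add, hV0, zero_add] at this
      exact this
    have hUG := U.2.1
    let V' : zeroSumMonoid G₀ := ⟨V, fun g hg => hUG g (Multiset.mem_of_le hV hg), hV0⟩
    let T' : zeroSumMonoid G₀ :=
      ⟨T, fun g hg => hUG g (by rw [hT]; exact Multiset.mem_add.2 (Or.inr hg)), hTs⟩
    have hU : U = V' + T' := Subtype.ext hT
    rcases h.isAddUnit_or_isAddUnit hU with h1 | h1
    · exact Or.inl ((isAddUnit_iff V').1 h1)
    · have : T = 0 := (isAddUnit_iff T').1 h1
      right; rw [hT, this, add_zero]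
  · rintro ⟨h0, -, hmin⟩
    refine ⟨fun h => h0 ((isAddUnit_iff U).1 h), fun {V T} hU => ?_⟩
    have hU' : (U : Multiset G) = V + T := congrArg Subtype.val hU
    rcases hmin V (hU' ▸ Multiset.le_add_right _ _) V.2.2 with h | h
    · exact Or.inl ((isAddUnit_iff V).2 h)
    · right
      rw [isAddUnit_iff]
      rw [h] at hU'
      exact left_eq_add.1 hU'

/-- Every factor of `B` is a subsequence of `B`, hence lies over `G₀`; the ambient subset does not
affect factorizations. -/
theorem lengthSet_eq_lengths {G₀ : Set G} (B : zeroSumMonoid G₀) :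
    lengthSet B = lengths (B : Multiset G) := by
  ext k
  constructor
  · rintro ⟨F, hF, rfl, rfl⟩
    refine ⟨F.map (zeroSumMonoid G₀).subtype, ?_, ?_, by simp⟩
    · intro U hU
      obtain ⟨V, hV, rfl⟩ := Multiset.mem_map.1 hU
      exact (addIrreducible_iff V).1 (hF V hV)
    · exact (map_multiset_sum (zeroSumMonoid G₀).subtype F).symm
  · rintro ⟨F, hF, hs, rfl⟩
    have hmem : ∀ U ∈ F, U ∈ zeroSumMonoid G₀ := fun U hU =>
      ⟨fun g hg => B.2.1 g (Multiset.mem_of_le (hs ▸ Multiset.le_sum_of_mem hU) hg), (hF U hU).2.1⟩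
    lift F to Multiset (zeroSumMonoid G₀) using hmem
    refine ⟨F, fun U hU => (addIrreducible_iff U).2 (hF U (Multiset.mem_map_of_mem _ hU)),
      Subtype.ext ?_, by simp⟩
    rw [← hs]
    exact map_multiset_sum (zeroSumMonoid G₀).subtype F

theorem mem_lengthSystem_iff {G₀ : Set G} {L : Set ℕ} :
    L ∈ lengthSystem G₀ ↔ ∃ S : Multiset G, (∀ g ∈ S, g ∈ G₀) ∧ S.sum = 0 ∧ lengths S = L := by
  constructor
  · rintro ⟨B, rfl⟩
    exact ⟨B, B.2.1, B.2.2, (lengthSet_eq_lengths B).symm⟩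
  · rintro ⟨S, h1, h2, rfl⟩
    exact ⟨⟨S, h1, h2⟩, lengthSet_eq_lengths _⟩

theorem zero_mem_lengths_zero : 0 ∈ lengths (0 : Multiset G) := ⟨0, by simp, by simp, by simp⟩

theorem add_mem_lengths {S T : Multiset G} {a b : ℕ} (ha : a ∈ lengths S) (hb : b ∈ lengths T) :
    a + b ∈ lengths (S + T) := by
  obtain ⟨F, hF, rfl, rfl⟩ := ha
  obtain ⟨E, hE, rfl, rfl⟩ := hb
  refine ⟨F + E, fun U hU => ?_, by simp, by simp⟩
  rcases Multiset.mem_add.1 hU with h | h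
  exacts [hF U h, hE U h]

theorem mul_mem_lengths {S : Multiset G} {a : ℕ} (ha : a ∈ lengths S) (n : ℕ) :
    n * a ∈ lengths (n • S) := by
  induction n with
  | zero => simpa using zero_mem_lengths_zero
  | succ n ih => rw [add_mul, one_mul, succ_nsmul]; exact add_mem_lengths ih ha

theorem lengths_nonempty {S : Multiset G} (hS : S.sum = 0) : (lengths S).Nonempty := by
  induction S using Multiset.strongInductionOn with
  | ih S ih =>
  by_cases h0 : S = 0
  · subst h0; exact ⟨0, zero_mem_lengths_zero⟩
  by_cases hm : IsMinZeroSum S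
  · exact ⟨1, {S}, by simpa using hm, by simp, by simp⟩
  · simp only [IsMinZeroSum, not_and, not_forall, not_or] at hm
    obtain ⟨V, hV, hVs, hV0, hVS⟩ := hm h0 hS
    obtain ⟨T, rfl⟩ := Multiset.le_iff_exists_add.1 hV
    rw [Multiset.sum_add, hVs, zero_add] at hS
    obtain ⟨a, ha⟩ := ih V (lt_of_le_of_ne hV hVS) hVs
    obtain ⟨b, hb⟩ := ih T (by
      refine lt_of_le_of_ne (Multiset.le_add_left _ _) fun h => hV0 ?_
      exact right_eq_add.1 h) hS
    exact ⟨a + b, add_mem_lengths ha hb⟩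

theorem le_card_of_mem_lengths {S : Multiset G} {k : ℕ} (hk : k ∈ lengths S) : k ≤ S.card := by
  obtain ⟨F, hF, rfl, rfl⟩ := hk
  induction F using Multiset.induction_on with
  | empty => simp
  | cons U F ih =>
    have h1 := ih fun V hV => hF V (Multiset.mem_cons_of_mem hV)
    have h2 := Multiset.card_pos.2 (hF U (Multiset.mem_cons_self _ _)).1
    simp only [Multiset.card_cons, Multiset.sum_cons, Multiset.card_add]
    omega

/-! ### Size bounds and stability of lengths under passing to subsequences. -/

omit [AddCommGroup G] in
theorem card_le_card_mul_of_count_le [Finite G] [DecidableEq G] {S : Multiset G} {c : ℕ}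
    (h : ∀ g, S.count g ≤ c) : S.card ≤ Nat.card G * c := by
  have := Fintype.ofFinite G
  rw [Nat.card_eq_fintype_card, ← Multiset.sum_count_eq_card (s := Finset.univ) (by simp)]
  simpa using Finset.sum_le_card_nsmul Finset.univ (fun g => S.count g) c fun g _ => h g

/-- A crude Davenport bound suffices: `|G|` copies of one element already have sum zero, so no
multiplicity exceeds `|G|`. -/
theorem IsMinZeroSum.card_le [Finite G] {U : Multiset G} (hU : IsMinZeroSum U) :
    U.card ≤ Nat.card G * Nat.card G := by
  classical
  refine card_le_card_mul_of_count_le fun g => ?_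
  by_contra! h
  have hle : Multiset.replicate (Nat.card G) g ≤ U := Multiset.le_count_iff_replicate_le.1 h.le
  have hpos : 0 < Nat.card G := Nat.card_pos
  rcases hU.2.2 _ hle (by simp) with h' | h'
  · have := congrArg Multiset.card h'
    simp only [Multiset.card_replicate, Multiset.card_zero] at this
    omega
  · rw [← h', Multiset.count_replicate_self] at h
    omega

theorem card_sum_le [Finite G] {F : Multiset (Multiset G)} (hF : ∀ U ∈ F, IsMinZeroSum U) :
    F.sum.card ≤ Nat.card G * Nat.card G * F.card := by
  induction F using Multiset.induction_on with
  | empty => simp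
  | cons U F ih =>
    have h1 := ih fun V hV => hF V (Multiset.mem_cons_of_mem hV)
    have h2 := (hF U (Multiset.mem_cons_self _ _)).card_le
    simp only [Multiset.card_cons, Multiset.sum_cons, Multiset.card_add, mul_add]
    omega

theorem card_le_of_mem_lengths [Finite G] {S : Multiset G} {k : ℕ} (hk : k ∈ lengths S) :
    S.card ≤ Nat.card G * Nat.card G * k := by
  obtain ⟨F, hF, rfl, rfl⟩ := hk
  exact card_sum_le hF

/-- Each term of `R` spoils at most one block of `F`; discarding the spoiled blocks leaves blocks
inside `W`. -/
theorem exists_le_sum_le {α : Type*} (R W : Multiset α) (F : Multiset (Multiset α))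
    (h : F.sum = W + R) : ∃ E ≤ F, E.sum ≤ W ∧ F.card ≤ E.card + R.card := by
  classical
  induction R using Multiset.induction_on generalizing W with
  | empty => exact ⟨F, le_rfl, by simp [h], by simp⟩
  | cons a R ih =>
    obtain ⟨E, hEF, hE, hc⟩ := ih (a ::ₘ W) (by rw [h]; simp)
    by_cases ha : a ∈ E.sum
    · obtain ⟨U, hU, haU⟩ := Multiset.mem_join.1 ha
      obtain ⟨D, rfl⟩ := Multiset.exists_cons_of_mem hU
      obtain ⟨V, rfl⟩ := Multiset.exists_cons_of_mem haU
      refine ⟨D, (Multiset.le_cons_self _ _).trans hEF, ?_, ?_⟩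
      · rw [Multiset.sum_cons, Multiset.cons_add, Multiset.cons_le_cons_iff] at hE
        exact (Multiset.le_add_left _ _).trans hE
      · simp only [Multiset.card_cons] at hc ⊢
        omega
    · refine ⟨E, hEF, (Multiset.le_cons_of_notMem ha).1 hE, ?_⟩
      simp only [Multiset.card_cons]
      omega

/-- Passing to a zero-sum subsequence changes the lengths by an amount which is bounded in terms
of the length of the complement. -/
theorem exists_mem_lengths_of_add [Finite G] {W R : Multiset G} (hW : W.sum = 0) {n : ℕ}
    (hn : n ∈ lengths (W + R)) : ∃ n' ∈ lengths W, n ≤ n' + R.card ∧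
      n' ≤ n + Nat.card G * Nat.card G * R.card := by
  obtain ⟨F, hF, hs, rfl⟩ := hn
  obtain ⟨E, hEF, hE, hc⟩ := exists_le_sum_le R W F hs
  obtain ⟨E', rfl⟩ := Multiset.le_iff_exists_add.1 hEF
  obtain ⟨V, rfl⟩ := Multiset.le_iff_exists_add.1 hE
  have hEmem : E.card ∈ lengths E.sum := ⟨E, fun U hU => hF U (Multiset.mem_add.2 (Or.inl hU)), rfl, rfl⟩
  have hEs : E.sum.sum = 0 := by
    rw [← Multiset.coe_sumAddMonoidHom, map_multiset_sum]
    refine Multiset.sum_eq_zero fun x hx => ?_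
    obtain ⟨U, hU, rfl⟩ := Multiset.mem_map.1 hx
    exact (hF U (Multiset.mem_add.2 (Or.inl hU))).2.1
  rw [Multiset.sum_add, hEs, zero_add] at hW
  obtain ⟨j, hj⟩ := lengths_nonempty hW
  -- The rest `V` of `W` is refactored into `j` atoms. It lies inside the at most `|R|` discarded
  -- blocks, each of size at most `|G|²`, which bounds `j`.
  refine ⟨_, add_mem_lengths hEmem hj, by omega, ?_⟩
  rw [Multiset.sum_add, add_assoc] at hs
  have h1 : V.card ≤ E'.sum.card := by rw [add_left_cancel hs]; simp
  have h2 := card_sum_le fun U hU => hF U (Multiset.mem_add.2 (Or.inr hU))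
  have h3 := le_card_of_mem_lengths hj
  rw [Multiset.card_add] at hc ⊢
  have h4 : Nat.card G * Nat.card G * E'.card ≤ Nat.card G * Nat.card G * R.card :=
    Nat.mul_le_mul_left _ (by omega)
  omega

/-! ### Distances and almost arithmetical progressions. -/

theorem exists_mem_distances {L : Set ℕ} {a b : ℕ} (ha : a ∈ L) (hb : b ∈ L) (hab : a < b) :
    ∃ d ∈ distances L, d ≤ b - a := by
  classical
  have hex : ∃ c, c ∈ L ∧ a < c := ⟨b, hb, hab⟩
  obtain ⟨hc, hac⟩ := Nat.find_spec hex
  refine ⟨_, ⟨a, ha, Nat.find hex, hc, hac, ?_, rfl⟩,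
    Nat.sub_le_sub_right (Nat.find_min' hex ⟨hb, hab⟩) a⟩
  ext x
  simp only [Set.mem_inter_iff, Set.mem_Icc, Set.mem_insert_iff, Set.mem_singleton_iff]
  constructor
  · rintro ⟨⟨h1, h2⟩, hx⟩
    rcases h1.eq_or_lt with h | h
    · exact Or.inl h.symm
    · exact Or.inr (le_antisymm h2 (Nat.find_min' hex ⟨hx, h⟩))
  · rintro (rfl | rfl)
    · exact ⟨⟨le_rfl, hac.le⟩, ha⟩
    · exact ⟨⟨hac.le, le_rfl⟩, hc⟩

theorem exists_mem_distanceSet {G₀ : Set G} {S : Multiset G} (hS : ∀ g ∈ S, g ∈ G₀)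
    (h0 : S.sum = 0) {a b : ℕ} (ha : a ∈ lengths S) (hb : b ∈ lengths S) (hab : a < b) :
    ∃ d ∈ distanceSet G₀, d ≤ b - a := by
  obtain ⟨d, hd, hle⟩ := exists_mem_distances ha hb hab
  exact ⟨d, Set.mem_biUnion (mem_lengthSystem_iff.2 ⟨S, hS, h0, rfl⟩) hd, hle⟩

theorem exists_of_mem_distanceSet {G₀ : Set G} {d : ℕ} (hd : d ∈ distanceSet G₀) :
    0 < d ∧ ∃ S : Multiset G, (∀ g ∈ S, g ∈ G₀) ∧ S.sum = 0 ∧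
      ∃ l, l ∈ lengths S ∧ l + d ∈ lengths S := by
  obtain ⟨L, hL, a, ha, b, hb, hab, -, rfl⟩ := Set.mem_iUnion₂.1 hd
  obtain ⟨S, hS, h0, rfl⟩ := mem_lengthSystem_iff.1 hL
  exact ⟨by omega, S, hS, h0, a, ha, by rwa [Nat.add_sub_cancel' hab.le]⟩

omit [AddCommGroup G] in
theorem nsmul_over {G₀ : Set G} {S : Multiset G} (hS : ∀ g ∈ S, g ∈ G₀) (n : ℕ) :
    ∀ g ∈ n • S, g ∈ G₀ := fun g hg => hS g (Multiset.mem_of_mem_nsmul hg)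

/-- The minimal distance divides all differences of lengths. -/
theorem sInf_distanceSet_dvd {G₀ : Set G} (h : (distanceSet G₀).Nonempty) {C : Multiset G}
    (hC : ∀ g ∈ C, g ∈ G₀) (hC0 : C.sum = 0) {x y : ℕ} (hx : x ∈ lengths C)
    (hy : y ∈ lengths C) (hxy : x ≤ y) : sInf (distanceSet G₀) ∣ y - x := by
  obtain ⟨hm, S, hS, hS0, l, hl, hl'⟩ := exists_of_mem_distanceSet (Nat.sInf_mem h)
  set m := sInf (distanceSet G₀)
  by_contra hdvd
  have hr : 0 < (y - x) % m := Nat.pos_of_ne_zero fun h => hdvd (Nat.dvd_of_mod_eq_zero h)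
  have hr' := Nat.mod_lt (y - x) hm
  have hdiv := Nat.div_add_mod (y - x) m
  set q := (y - x) / m
  -- Division with remainder: `C + q • S` has two lengths differing by `(y - x) % m`, a positive
  -- number below the minimal distance `m`.
  have h1 := add_mem_lengths hx (mul_mem_lengths hl' q)
  have h2 := add_mem_lengths hy (mul_mem_lengths hl q)
  have h3 : y + q * l = x + q * (l + m) + (y - x) % m := by
    rw [mul_add, mul_comm q m]; omega
  obtain ⟨d, hd, hle⟩ := exists_mem_distanceSet (G₀ := G₀) (S := C + q • S) (by
      intro g hg
      rcases Multiset.mem_add.1 hg with hg | hg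
      exacts [hC g hg, nsmul_over hS q g hg]) (by simp [hC0, hS0, Multiset.sum_nsmul]) h1 h2 (by omega)
  have : m ≤ d := Nat.sInf_le hd
  omega

theorem isAAP_of_progression {L : Set ℕ} {m k y N : ℕ} (hN : ∀ x ∈ L, x ≤ N)
    (hy : ∀ i ≤ k, y + i * m ∈ L) (hdvd : ∀ x ∈ L, (m : ℤ) ∣ x - y) (hm : 0 < m) :
    IsAAP m k L := by
  refine ⟨N + y, y, {z | z < 0 ∧ ∃ x ∈ L, (x : ℤ) = y + z},
    {z | (k : ℤ) * m < z ∧ ∃ x ∈ L, (x : ℤ) = y + z}, ?_, ?_, ?_, ?_⟩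
  · rintro z ⟨hz, x, hx, hxz⟩
    constructor <;> push_cast <;> omega
  · rintro z ⟨hz, x, hx, hxz⟩
    have := hN x hx
    have h0 : (0 : ℤ) ≤ (k : ℤ) * m := by positivity
    constructor <;> push_cast <;> linarith
  · ext z
    constructor
    · rintro ⟨x, hx, rfl⟩
      refine ⟨x - y, ?_, by ring⟩
      rcases lt_or_ge ((x : ℤ) - y) 0 with h | h
      · exact Or.inl (Or.inl ⟨h, x, hx, by ring⟩)
      rcases lt_or_ge ((k : ℤ) * m) ((x : ℤ) - y) with h' | h'
      · exact Or.inr ⟨h', x, hx, by ring⟩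
      refine Or.inl (Or.inr ?_)
      obtain ⟨c, hc⟩ := hdvd x hx
      have hm' : (0 : ℤ) < m := by exact_mod_cast hm
      have hc0 : 0 ≤ c := by
        by_contra! hneg
        nlinarith
      lift c to ℕ using hc0
      refine ⟨c, ?_, by rw [hc, mul_comm]⟩
      rw [hc, mul_comm] at h'
      exact_mod_cast le_of_mul_le_mul_right h' hm'
    · rintro ⟨z, (⟨-, x, hx, h⟩ | ⟨i, hi, rfl⟩) | ⟨-, x, hx, h⟩, rfl⟩
      · exact ⟨x, hx, h⟩
      · exact ⟨_, hy i hi, by push_cast; rfl⟩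
      · exact ⟨x, hx, h⟩
  · rintro _ ⟨x, hx, rfl⟩
    exact hdvd x hx

theorem IsAAP.exists_add_mul_mem {L : Set ℕ} {d k : ℕ} (h : IsAAP d k L) :
    (∃ a ∈ L, a + k * d ∈ L) ∧ ∀ x ∈ L, ∀ z, x + z ∈ L → d ∣ z := by
  obtain ⟨M, y, L', L'', -, -, hL, hdvd⟩ := h
  constructor
  · have key : ∀ i ≤ k, y + (i : ℤ) * d ∈ (fun n : ℕ => (n : ℤ)) '' L := fun i hi => by
      rw [hL]
      exact ⟨_, Or.inl (Or.inr ⟨i, hi, rfl⟩), rfl⟩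
    obtain ⟨a, ha, hay⟩ := key 0 (Nat.zero_le _)
    obtain ⟨b, hb, hby⟩ := key k le_rfl
    refine ⟨a, ha, ?_⟩
    have : b = a + k * d := by
      zify
      simp only at hay hby
      rw [hay, hby]; simp
    rwa [← this]
  · intro x hx z hz
    have h1 := hdvd _ ⟨x, hx, rfl⟩
    have h2 := hdvd _ ⟨_, hz, rfl⟩
    have h3 := dvd_sub h2 h1
    have h4 : (((x + z : ℕ) : ℤ) - y - ((x : ℤ) - y)) = z := by push_cast; ring
    simp only [h4] at h3
    exact_mod_cast h3

/-! ### Elasticities and limits of ratios. -/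

theorem div_le_elasticity {L : Set ℕ} {a b : ℕ} (ha : a ∈ L) (hb : b ∈ L) :
    (a : ℝ≥0∞) / b ≤ elasticity L := by
  unfold elasticity
  split_ifs with h
  · subst h
    rw [Set.mem_singleton_iff] at ha
    simp [ha]
  · exact ENNReal.div_le_div (le_iSup₂ (f := fun (n : ℕ) (_ : n ∈ L) => (n : ℝ≥0∞)) a ha)
      (by exact_mod_cast Nat.sInf_le hb)

theorem exists_lt_div_of_lt_elasticity {L : Set ℕ} {r : ℝ≥0∞} (h0 : L ≠ {0})
    (hr : r < elasticity L) : ∃ a ∈ L, r < (a : ℝ≥0∞) / (sInf L : ℕ) := by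
  unfold elasticity at hr
  rw [if_neg h0, ENNReal.iSup_div] at hr
  obtain ⟨a, ha⟩ := lt_iSup_iff.1 hr
  rw [ENNReal.iSup_div] at ha
  obtain ⟨haL, ha⟩ := lt_iSup_iff.1 ha
  exact ⟨a, haL, ha⟩

theorem le_of_forall_exists_mul_le {x y c : ℝ≥0∞} (hc : c ≠ ⊤)
    (h : ∀ N : ℕ, ∃ j : ℕ, N ≤ j ∧ x * j ≤ y * j + c) : x ≤ y := by
  by_contra! hlt
  have hy : y ≠ ⊤ := hlt.ne_top
  obtain ⟨r, hyr, hrx⟩ := ENNReal.lt_iff_exists_nnreal_btwn.1 hlt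
  lift y to NNReal using hy
  lift c to NNReal using hc
  have hyr' : (y : ℝ) < r := by exact_mod_cast hyr
  obtain ⟨N, hN⟩ := exists_nat_gt ((c : ℝ) / (r - y))
  obtain ⟨j, hj, hle⟩ := h N
  have h1 : (r : ℝ≥0∞) * j ≤ y * j + c := le_trans (by gcongr) hle
  have h2 : (r : ℝ) * j ≤ y * j + c := by exact_mod_cast h1
  rw [div_lt_iff₀ (by linarith)] at hN
  have h3 : (N : ℝ) ≤ j := by exact_mod_cast hj
  nlinarith

/-! ### Elasticities of subsets are bounded by `rho`. -/

theorem rho_le_rhoLevel (d k : ℕ) : rho G d ≤ rhoLevel G d k := by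
  have h : Antitone fun k : ℕ => rhoLevel G d k := by
    intro k m hkm
    refine sSup_le_sSup ?_
    rintro r ⟨L, hL, ⟨ℓ, hℓ, hA⟩, rfl⟩
    exact ⟨L, hL, ⟨ℓ, hkm.trans hℓ, hA⟩, rfl⟩
  exact h.le_of_tendsto (tendsto_rhoLevel G d) k

theorem setElasticity_le_rho {G₀ : Set G} (h : (distanceSet G₀).Nonempty) :
    setElasticity G₀ ≤ rho G (sInf (distanceSet G₀)) := by
  refine ge_of_tendsto' (tendsto_rhoLevel G _) fun k => ?_
  obtain ⟨hm, S, hS, hS0, l, hl, hl'⟩ := exists_of_mem_distanceSet (Nat.sInf_mem h)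
  have hdvd := @sInf_distanceSet_dvd G _ G₀ h
  set m := sInf (distanceSet G₀)
  have hlevel : ∀ A : Multiset G, (∀ g ∈ A, g ∈ G₀) → A.sum = 0 →
      elasticity (lengths (k • S + A)) ≤ rhoLevel G m k := by
    intro A hA hA0
    have hsum : (k • S + A).sum = 0 := by simp [hA0, hS0, Multiset.sum_nsmul]
    refine le_sSup ⟨_, mem_lengthSystem_iff.2 ⟨k • S + A, fun _ _ => trivial, hsum, rfl⟩,
      ⟨k, le_rfl, ?_⟩, rfl⟩
    obtain ⟨n, hn⟩ := lengths_nonempty hA0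
    -- Factor `i` copies of `S` with length `l + m` and the other `k - i` with length `l`.
    have hprog : ∀ i ≤ k, k * l + n + i * m ∈ lengths (k • S + A) := by
      intro i hi
      obtain ⟨j, rfl⟩ := Nat.exists_eq_add_of_le hi
      have := add_mem_lengths (add_mem_lengths (mul_mem_lengths hl' i) (mul_mem_lengths hl j)) hn
      rw [← add_nsmul] at this
      convert this using 1
      ring
    refine isAAP_of_progression (fun x hx => le_card_of_mem_lengths hx) hprog ?_ hm
    intro x hx
    have hy := hprog 0 (Nat.zero_le _)
    rw [zero_mul, add_zero] at hy
    have hG : ∀ g ∈ k • S + A, g ∈ G₀ := by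
      intro g hg
      rcases Multiset.mem_add.1 hg with hg | hg
      exacts [nsmul_over hS k g hg, hA g hg]
    rcases le_total x (k * l + n) with hle | hle
    · rw [← dvd_neg, neg_sub, ← Nat.cast_sub hle]
      exact_mod_cast hdvd hG hsum hx hy hle
    · rw [← Nat.cast_sub hle]
      exact_mod_cast hdvd hG hsum hy hx hle
  refine iSup₂_le fun L hL => ?_
  obtain ⟨A, hA, hA0, rfl⟩ := mem_lengthSystem_iff.1 hL
  by_cases hLA : lengths A = {0}
  · have h1 := add_mem_lengths (mul_mem_lengths hl' k) hl'
    have h2 := (div_le_elasticity h1 h1).trans (hlevel S hS hS0)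
    rw [ENNReal.div_self (by norm_cast; omega) (ENNReal.natCast_ne_top _)] at h2
    rwa [hLA, elasticity, if_pos rfl]
  rcases eq_or_ne (rhoLevel G m k) ⊤ with htop | htop
  · rw [htop]; exact le_top
  refine le_of_forall_lt fun r hr => ?_
  obtain ⟨a, ha, hra⟩ := exists_lt_div_of_lt_elasticity hLA hr
  refine hra.trans_le ?_
  have hn := Nat.sInf_mem (lengths_nonempty hA0)
  set n := sInf (lengths A)
  have hn0 : n ≠ 0 := by
    intro h0
    rw [h0] at hn
    obtain ⟨F, hF, hs, hc⟩ := hn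
    rw [Multiset.card_eq_zero] at hc
    subst hc
    rw [Multiset.sum_zero] at hs
    subst hs
    refine hLA (Set.eq_singleton_iff_unique_mem.2 ⟨zero_mem_lengths_zero, fun x hx => ?_⟩)
    simpa using le_card_of_mem_lengths hx
  have hn0' : (n : ℝ≥0∞) ≠ 0 := by exact_mod_cast hn0
  rw [ENNReal.div_le_iff_le_mul (Or.inl hn0') (Or.inl (ENNReal.natCast_ne_top _))]
  -- The constant is the contribution of `k • S`, negligible against `j • A` as `j` grows.
  refine le_of_forall_exists_mul_le (c := rhoLevel G m k * (k * l : ℕ))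
    (ENNReal.mul_ne_top htop (ENNReal.natCast_ne_top _)) fun N => ⟨N + 1, by omega, ?_⟩
  have h1 := add_mem_lengths (mul_mem_lengths hl k) (mul_mem_lengths ha (N + 1))
  have h2 := add_mem_lengths (mul_mem_lengths hl k) (mul_mem_lengths hn (N + 1))
  have h3 := (div_le_elasticity h1 h2).trans
    (hlevel ((N + 1) • A) (nsmul_over hA _) (by simp [hA0, Multiset.sum_nsmul]))
  have h4 : k * l + (N + 1) * n ≠ 0 := by positivity
  rw [ENNReal.div_le_iff_le_mul (Or.inl (by exact_mod_cast h4))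
    (Or.inl (ENNReal.natCast_ne_top _))] at h3
  calc (a : ℝ≥0∞) * ((N + 1 : ℕ) : ℝ≥0∞) ≤ ((k * l + (N + 1) * a : ℕ) : ℝ≥0∞) := by
        rw [← Nat.cast_mul, mul_comm a]
        exact_mod_cast Nat.le_add_left _ _
    _ ≤ _ := h3
    _ = _ := by push_cast; ring

/-! ### Reduction to the elements of large multiplicity. -/

open scoped Classical in
/-- A large zero-sum subsequence over `G₀`, made of multiples of `|G|` copies of each element. -/
theorem exists_zeroSum_le [Finite G] (B : Multiset G) (G₀ : Set G) (c : ℕ)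
    (hc : ∀ g ∉ G₀, B.count g ≤ c) : ∃ W R : Multiset G, B = W + R ∧ (∀ g ∈ W, g ∈ G₀) ∧
      W.sum = 0 ∧ R.card ≤ Nat.card G * (c + Nat.card G) := by
  have := Fintype.ofFinite G
  set e := Nat.card G
  have he : 0 < e := Nat.card_pos
  let f : G → ℕ := fun g => if g ∈ G₀ then e * (B.count g / e) else 0
  let W : Multiset G := ∑ g, Multiset.replicate (f g) g
  have hcount : ∀ g, W.count g = f g := by
    intro g
    simp [W, Multiset.count_sum', Multiset.count_replicate]
  have hWB : W ≤ B := by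
    rw [Multiset.le_iff_count]
    intro g
    rw [hcount]
    simp only [f]
    split_ifs
    · exact Nat.mul_div_le _ _
    · exact Nat.zero_le _
  refine ⟨W, B - W, (add_tsub_cancel_of_le hWB).symm, fun g hg => ?_, ?_, ?_⟩
  · by_contra hg0
    have := Multiset.count_pos.2 hg
    rw [hcount] at this
    simp [f, hg0] at this
  · simp only [W]
    rw [← Multiset.coe_sumAddMonoidHom, map_sum]
    refine Finset.sum_eq_zero fun g _ => ?_
    simp only [f, Multiset.coe_sumAddMonoidHom, Multiset.sum_replicate]
    split_ifs
    · rw [mul_comm, mul_nsmul']; simp [e]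
    · simp
  · refine card_le_card_mul_of_count_le fun g => ?_
    rw [Multiset.count_sub, hcount]
    simp only [f]
    split_ifs with hg
    · have := Nat.div_add_mod (B.count g) e
      have := Nat.mod_lt (B.count g) he
      omega
    · have := hc g hg
      omega

omit [AddCommGroup G] in
/-- Along an ultrafilter, each multiplicity is either bounded or tends to infinity. -/
theorem exists_support_at_infinity [Finite G] [DecidableEq G] (B : ℕ → Multiset G) :
    ∃ (G₀ : Set G) (c : ℕ), ∀ N : ℕ, ∃ k ≥ N,
      (∀ g ∈ G₀, N ≤ (B k).count g) ∧ ∀ g ∉ G₀, (B k).count g ≤ c := by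
  classical
  have := Fintype.ofFinite G
  -- An ultrafilter decides bounded or unbounded for all elements at once, replacing repeated
  -- extraction of subsequences.
  let U : Ultrafilter ℕ := Filter.hyperfilter ℕ
  let G₀ : Set G := {g | ∀ N : ℕ, ∀ᶠ k in U, N ≤ (B k).count g}
  have hb : ∀ g, ∃ N : ℕ, g ∉ G₀ → ∀ᶠ k in U, (B k).count g ≤ N := by
    intro g
    by_cases hg : g ∈ G₀
    · exact ⟨0, fun h => absurd hg h⟩
    · simp only [G₀, Set.mem_ofPred_eq, not_forall] at hg
      obtain ⟨N, hN⟩ := hg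
      refine ⟨N, fun _ => ?_⟩
      filter_upwards [Ultrafilter.eventually_not.2 hN] with k hk
      omega
  choose M hM using hb
  refine ⟨G₀, ∑ g, M g, fun N => ?_⟩
  have h1 : ∀ᶠ k in U, N ≤ k := by
    have hU : (U : Filter ℕ) ≤ Filter.atTop := by
      rw [← Nat.cofinite_eq_atTop]; exact Filter.hyperfilter_le_cofinite
    exact hU (Filter.eventually_ge_atTop N)
  have h2 : ∀ᶠ k in U, ∀ g, g ∈ G₀ → N ≤ (B k).count g := by
    rw [Filter.eventually_all]
    intro g
    by_cases hg : g ∈ G₀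
    · filter_upwards [hg N] with k hk _ using hk
    · exact Filter.Eventually.of_forall fun k h => absurd h hg
  have h3 : ∀ᶠ k in U, ∀ g, g ∉ G₀ → (B k).count g ≤ ∑ g, M g := by
    rw [Filter.eventually_all]
    intro g
    by_cases hg : g ∈ G₀
    · exact Filter.Eventually.of_forall fun k h => absurd hg h
    · filter_upwards [hM g hg] with k hk _
      exact hk.trans (Finset.single_le_sum (fun _ _ => Nat.zero_le _) (Finset.mem_univ g))
  obtain ⟨k, hk1, hk2, hk3⟩ := (h1.and (h2.and h3)).exists
  exact ⟨k, hk1, hk2, hk3⟩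

theorem rho_le_rhoStar [Finite G] {d : ℕ} (hd : 0 < d) : rho G d ≤ rhoStar G d := by
  classical
  refine le_of_forall_lt_imp_le_of_dense fun r hr => ?_
  have hex : ∀ k : ℕ, ∃ B : Multiset G, B.sum = 0 ∧ (∃ ℓ, k + 1 ≤ ℓ ∧ IsAAP d ℓ (lengths B)) ∧
      r < elasticity (lengths B) := by
    intro k
    obtain ⟨_, ⟨L, hL, hA, rfl⟩, hlt⟩ := lt_sSup_iff.1 (hr.trans_le (rho_le_rhoLevel d (k + 1)))
    obtain ⟨B, -, hB0, rfl⟩ := mem_lengthSystem_iff.1 hL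
    exact ⟨B, hB0, hA, hlt⟩
  choose B hB0 hA hlt using hex
  have hgap : ∀ k, ∃ a ∈ lengths (B k), ∃ b ∈ lengths (B k), a + k < b := by
    intro k
    obtain ⟨ℓ, hℓ, h⟩ := hA k
    obtain ⟨a, ha, hb⟩ := h.exists_add_mul_mem.1
    refine ⟨a, ha, _, hb, ?_⟩
    have : ℓ * 1 ≤ ℓ * d := Nat.mul_le_mul_left _ hd
    omega
  obtain ⟨G₀, c, hG₀⟩ := exists_support_at_infinity B
  obtain ⟨Q, hQdef⟩ : ∃ Q, Q = Nat.card G * (c + Nat.card G) := ⟨_, rfl⟩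
  have hne : (distanceSet G₀).Nonempty := by
    by_contra hemp
    rw [Set.not_nonempty_iff_eq_empty] at hemp
    -- With this gap, lengths `a` and `b` of `B k` stay distinct after one rises by at most `|G|²Q`
    -- and the other drops by at most `Q`.
    obtain ⟨k, hk, -, hk2⟩ := hG₀ (Q + Nat.card G * Nat.card G * Q)
    obtain ⟨W, R, hWR, hW, hW0, hR⟩ := exists_zeroSum_le (B k) G₀ c hk2
    rw [← hQdef] at hR
    obtain ⟨a, ha, b, hb, hab⟩ := hgap k
    rw [hWR] at ha hb
    obtain ⟨a', ha', -, ha2⟩ := exists_mem_lengths_of_add hW0 ha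
    obtain ⟨b', hb', hb1, -⟩ := exists_mem_lengths_of_add hW0 hb
    have : Nat.card G * Nat.card G * R.card ≤ Nat.card G * Nat.card G * Q := Nat.mul_le_mul_left _ hR
    obtain ⟨x, hx, -⟩ := exists_mem_distanceSet hW hW0 ha' hb' (by omega)
    rw [hemp] at hx
    exact hx
  have hdvd : d ∣ sInf (distanceSet G₀) := by
    obtain ⟨-, C, hC, hC0, l, hl, hl'⟩ := exists_of_mem_distanceSet (Nat.sInf_mem hne)
    -- `C` realizes the minimal distance of `G₀` and divides some `B k`, whose lengths all agree
    -- modulo `d`.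
    obtain ⟨k, -, hk1, -⟩ := hG₀ C.card
    have hle : C ≤ B k := by
      rw [Multiset.le_iff_count]
      intro g
      by_cases hg : g ∈ C
      · exact (Multiset.count_le_card _ _).trans (hk1 g (hC g hg))
      · simp [Multiset.count_eq_zero_of_notMem hg]
    obtain ⟨T, hT⟩ := Multiset.le_iff_exists_add.1 hle
    have hT0 : T.sum = 0 := by
      have := hB0 k
      rwa [hT, Multiset.sum_add, hC0, zero_add] at this
    obtain ⟨x, hx⟩ := lengths_nonempty hT0
    obtain ⟨ℓ, -, h⟩ := hA k
    rw [hT] at h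
    refine h.exists_add_mul_mem.2 _ (add_mem_lengths hl hx) _ ?_
    rw [add_right_comm]
    exact add_mem_lengths hl' hx
  refine le_trans ?_ (le_sSup ⟨G₀, hne, hdvd, rfl⟩ : setElasticity G₀ ≤ rhoStar G d)
  rcases eq_or_ne (setElasticity G₀) ⊤ with htop | htop
  · rw [htop]; exact le_top
  refine le_of_forall_exists_mul_le
    (c := setElasticity G₀ * (Nat.card G * Nat.card G * Q : ℕ) + (Q : ℕ)) (by finiteness) fun N => ?_
  obtain ⟨k, hk, -, hk2⟩ := hG₀ (Nat.card G * Nat.card G * N)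
  obtain ⟨W, R, hWR, hW, hW0, hR⟩ := exists_zeroSum_le (B k) G₀ c hk2
  rw [← hQdef] at hR
  obtain ⟨u, hu, b, hb, hub⟩ := hgap k
  have hn := Nat.sInf_mem (lengths_nonempty (hB0 k))
  obtain ⟨a, ha, hra⟩ := exists_lt_div_of_lt_elasticity (by
    intro h
    rw [h, Set.mem_singleton_iff] at hb
    omega) (hlt k)
  set n := sInf (lengths (B k))
  -- A length above `|G|²N` forces `|B k| > |G|²N`, while `|B k| ≤ |G|²n`; so the minimal length
  -- tends to infinity.
  have hNn : N ≤ n := by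
    have h1 := le_card_of_mem_lengths hb
    have h2 := card_le_of_mem_lengths hn
    have h3 : Nat.card G * Nat.card G * N ≤ Nat.card G * Nat.card G * n := by omega
    have he : 0 < Nat.card G := Nat.card_pos
    exact le_of_mul_le_mul_left h3 (by positivity)
  refine ⟨n, hNn, (ENNReal.mul_le_of_le_div hra.le).trans ?_⟩
  rw [hWR] at ha hn
  obtain ⟨a', ha', ha1, -⟩ := exists_mem_lengths_of_add hW0 ha
  obtain ⟨n', hn', -, hn2⟩ := exists_mem_lengths_of_add hW0 hn
  have hQ : Nat.card G * Nat.card G * R.card ≤ Nat.card G * Nat.card G * Q := Nat.mul_le_mul_left _ hR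
  have hmul : (a' : ℝ≥0∞) ≤ setElasticity G₀ * n' := by
    rcases eq_or_ne n' 0 with h0 | h0
    · have h1 := le_card_of_mem_lengths ha'
      have h2 := card_le_of_mem_lengths hn'
      rw [h0, mul_zero] at h2
      have : a' = 0 := by omega
      simp [this]
    · rw [← ENNReal.div_le_iff_le_mul (Or.inl (by exact_mod_cast h0))
        (Or.inl (ENNReal.natCast_ne_top _))]
      exact (div_le_elasticity ha' hn').trans
        (le_iSup₂ (f := fun (L : Set ℕ) (_ : L ∈ lengthSystem G₀) => elasticity L) _
          (mem_lengthSystem_iff.2 ⟨W, hW, hW0, rfl⟩))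
  calc (a : ℝ≥0∞) ≤ (a' + Q : ℕ) := by exact_mod_cast (by omega : a ≤ a' + Q)
    _ = a' + (Q : ℕ) := by push_cast; rfl
    _ ≤ setElasticity G₀ * n' + (Q : ℕ) := by gcongr
    _ ≤ setElasticity G₀ * (n + Nat.card G * Nat.card G * Q : ℕ) + (Q : ℕ) := by
        gcongr
        omega
    _ = _ := by push_cast; ring

/-- The invariant `ρ*(G, d)` is determined by the invariants `ρ(G, m)`. -/
theorem rhoStar_eq_iSup_rho [Finite G] (d : ℕ) :
    rhoStar G d = ⨆ m : ℕ, ⨆ _ : 0 < m ∧ d ∣ m, rho G m := by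
  apply le_antisymm
  · refine sSup_le ?_
    rintro _ ⟨G₀, hne, hd, rfl⟩
    exact (setElasticity_le_rho hne).trans
      (le_iSup₂ (f := fun (m : ℕ) (_ : 0 < m ∧ d ∣ m) => rho G m) _
        ⟨(exists_of_mem_distanceSet (Nat.sInf_mem hne)).1, hd⟩)
  -- For `d ∣ m`, subsets admissible for `m` are admissible for `d`.
  · refine iSup₂_le fun m hm => (rho_le_rhoStar hm.1).trans (sSup_le_sSup ?_)
    rintro _ ⟨G₀, hne, hd, rfl⟩
    exact ⟨G₀, hne, hm.2.trans hd, rfl⟩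

end Multisets

end ZeroSumLengths

theorem proposition3p5 {G : Type*} [AddCommGroup G] [Finite G]
    {G' : Type*} [AddCommGroup G'] [Finite G']
    (hL : ZeroSumLengths.lengthSystem (Set.univ : Set G) =
      ZeroSumLengths.lengthSystem (Set.univ : Set G'))
    (d : ℕ) (hd : d ∈ ZeroSumLengths.Delta₁ G) :
    d ∈ ZeroSumLengths.Delta₁ G' ∧
      ZeroSumLengths.rho G d = ZeroSumLengths.rho G' d ∧
      ZeroSumLengths.rhoStar G d = ZeroSumLengths.rhoStar G' d := by
  have hrho : ∀ m, ZeroSumLengths.rho G m = ZeroSumLengths.rho G' m := fun m => by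
    simp only [ZeroSumLengths.rho, ZeroSumLengths.rhoLevel, hL]
  refine ⟨?_, hrho d, ?_⟩
  · simpa only [ZeroSumLengths.Delta₁, hL] using hd
  · simp only [ZeroSumLengths.rhoStar_eq_iSup_rho, hrho]
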